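/- Let $G$ be a finite simple graph. A matching of $G$ is a set of pairwise non-adjacent edges, and the matching polytope $\mathcal M_G\subset\mathbb R^{E(G)}$ is the convex hull of the $(0,1)$-indicator vectors of all matchings of $G$. Let $G'$ be an odd subdivision of $G$, i.e. a graph obtained from $G$ by replacing each edge by a path of odd length (length $1$ allowed, the paths being internally disjoint with new inner vertices). Then $\mathcal M_{G'}$ has a face $F$ that is unimodularly isomorphic to $\mathcal M_G$: there is an affine isomorphism from the affine hull of $F$ onto the affine hull of $\mathcal M_G$ that maps $F$ onto $\mathcal M_G$ and the integer points of the first affine hull onto the integer points of the second. Moreover, for every field $\mathbb K$, $$\omega(I_{\mathcal M_G})\le\omega(I_{\mathcal M_{G'}}).$$ Here, for a lattice polytope $\mathcal P\subset\mathbb R^m_{\ge 0}$, $I_{\mathcal P}$ is the toric ideal of $\mathcal P$, the kernel of the homomorphism $\mathbb K[x_{\mathbf a}:\mathbf a\in\mathcal P\cap\mathbb Z^m]\to\mathbb K[t_1,\dots,t_m,s]$, $x_{\mathbf a}\mapsto \mathbf t^{\mathbf a}s$, and for a homogeneous ideal $I$ (every variable having degree $1$), $\omega(I)$ is the maximal degree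 of an element of a minimal system of homogeneous generators of $I$, with the convention $\omega(\{0\})=2$. -/

import Mathlib

/-- A subdivision of the simple graph `G` in which every edge is replaced by a path of odd length,
realized as the simple graph `G'`: the vertices of `G` are embedded in `G'`, each edge of `G` is
replaced by a path of odd length between the images of its ends, the paths have no common vertices
except at their ends, and `G'` has no other vertices and edges. -/
structure OddSubdivision {V W : Type*} (G : SimpleGraph V) (G' : SimpleGraph W) where
  /-- the embedding of the original vertices -/
  vert : V ↪ W
  /-- the path that replaces the edge `uv`, traversed from `u` to `v` -/
  path : ∀ {u v : V}, G.Adj u v → G'.Walk (vert u) (vert v)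
  isPath : ∀ {u v : V} (h : G.Adj u v), (path h).IsPath
  odd_length : ∀ {u v : V} (h : G.Adj u v), Odd (path h).length
  /-- there is one path for each edge: the other direction gives the same path reversed -/
  path_symm : ∀ {u v : V} (h : G.Adj u v), path h.symm = (path h).reverse
  /-- the inner vertices of the paths are new vertices -/
  inner_new : ∀ {u v : V} (h : G.Adj u v) (x : V),
    vert x ∈ (path h).support → x = u ∨ x = v
  /-- the paths of different edges share no new vertex -/
  inner_disjoint : ∀ {u v x y : V} (h : G.Adj u v) (k : G.Adj x y), s(u, v) ≠ s(x, y) →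
    ∀ w, w ∈ (path h).support → w ∈ (path k).support → w ∈ Set.range vert
  /-- every vertex of `G'` is an original vertex or lies on one of the paths -/
  vertex_cover : ∀ w : W, w ∈ Set.range vert ∨
    ∃ (u v : V) (h : G.Adj u v), w ∈ (path h).support
  /-- every edge of `G'` lies on one of the paths -/
  edge_cover : ∀ e ∈ G'.edgeSet, ∃ (u v : V) (h : G.Adj u v), e ∈ (path h).edges

/-- `G'` is (up to renaming its vertices) an odd subdivision of `G`. -/
def IsOddSubdivision {V W : Type*} (G : SimpleGraph V) (G' : SimpleGraph W) : Prop :=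
  Nonempty (OddSubdivision G G')

/-- The (full) matching polytope of `G` in `ℝ^E(G)`: the convex hull of the `(0,1)`-vectors of the
matchings of `G`, that is, of the sets of pairwise non-adjacent edges. -/
def matchingPolytope {V : Type*} (G : SimpleGraph V) : Set (G.edgeSet → ℝ) :=
  convexHull ℝ
    {x | ∃ M : Set G.edgeSet, G.lineGraph.IsIndepSet M ∧ x = M.indicator (fun _ => (1 : ℝ))}

/-- The lattice `ℤ^ι` in `ℝ^ι`. -/
def integerPoints (ι : Type*) : Set (ι → ℝ) :=
  {x | ∀ i, ∃ n : ℤ, x i = n}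

/-- `P ⊆ ℝ^ι` and `Q ⊆ ℝ^κ` are unimodularly isomorphic: there is an affine isomorphism between
their affine hulls that carries `P` onto `Q` and the lattice points of the affine hull of `P` onto
those of the affine hull of `Q`. The isomorphism is given by an affine map of the ambient spaces,
of which only the restriction to the affine hull of `P` matters; it is onto the affine hull of `Q`
as `P` is mapped onto `Q`. -/
def UnimodularlyIsomorphic {ι κ : Type*} (P : Set (ι → ℝ)) (Q : Set (κ → ℝ)) : Prop :=
  ∃ f : (ι → ℝ) →ᵃ[ℝ] (κ → ℝ),
    Set.InjOn f (affineSpan ℝ P : Set (ι → ℝ)) ∧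
    f '' P = Q ∧
    f '' ((affineSpan ℝ P : Set (ι → ℝ)) ∩ integerPoints ι) =
      (affineSpan ℝ Q : Set (κ → ℝ)) ∩ integerPoints κ

/-- The points of `P ∩ ℤ^ι` with nonnegative coordinates (for finite `ι`). -/
def LatticePoint {ι : Type*} (P : Set (ι → ℝ)) : Type _ :=
  {a : ι →₀ ℕ // (fun i => (a i : ℝ)) ∈ P}

/-- The homomorphism `K[x_a : a ∈ P ∩ ℤ^ι] → K[t, s]`, `x_a ↦ t^a s`; the variable `t_i` is
`X (some i)`, the variable `s` is `X none`. Its image is the toric ring of `P`. -/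
noncomputable def toricMap (K : Type*) [Field K] {ι : Type*} (P : Set (ι → ℝ)) :
    MvPolynomial (LatticePoint P) K →ₐ[K] MvPolynomial (Option ι) K :=
  MvPolynomial.aeval fun a =>
    MvPolynomial.rename some (MvPolynomial.monomial a.1 1) * MvPolynomial.X none

/-- The toric ideal of a lattice polytope `P`. -/
noncomputable def toricIdeal (K : Type*) [Field K] {ι : Type*} (P : Set (ι → ℝ)) :
    Ideal (MvPolynomial (LatticePoint P) K) :=
  RingHom.ker (toricMap K P)

/-- `S` is a minimal system of homogeneous generators of `I` (every variable has degree `1`). -/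
structure IsMinimalGenerators {σ K : Type*} [Field K] (I : Ideal (MvPolynomial σ K))
    (S : Set (MvPolynomial σ K)) : Prop where
  homogeneous : ∀ f ∈ S, ∃ n : ℕ, f.IsHomogeneous n
  span_eq : Ideal.span S = I
  minimal : ∀ T, T ⊂ S → Ideal.span T ≠ I

open Classical in
/-- `ω(I)`, the maximal degree of minimal generators of the homogeneous ideal `I`, with the
convention `ω(0) = 2`. (The degrees that occur are the same for all minimal systems of homogeneous
generators. The value is finite when `I` is homogeneous and there are finitely many variables;
`ℕ∞` only avoids a junk value of the supremum.) -/
noncomputable def omegaDegree {σ K : Type*} [Field K] (I : Ideal (MvPolynomial σ K)) : ℕ∞ :=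
  if I = ⊥ then 2
  else sSup {d : ℕ∞ | ∃ S, IsMinimalGenerators I S ∧ ∃ f ∈ S, d = (f.totalDegree : ℕ∞)}

/-!
A toric ideal is spanned by the differences of monomials with the same image. If such a difference
involves only lattice points of a face in one of its monomials, then it does so in the other, as a
linear functional that exposes the face has the same value on both. So the homomorphism that kills
the variables outside the face maps the toric ideal onto the toric ideal of the face, and it sends a
minimal system of homogeneous generators to homogeneous generators of the same degrees. Hence `ω`
does not increase on passing to a face (a toric ideal has no generators of degree less than `2`,
which agrees with the convention `ω(0) = 2`), and it is invariant under unimodular isomorphism.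

The face of the matching polytope of an odd subdivision consists of the points whose coordinates on
any two consecutive edges of a path add up to `1`. They alternate between `t` and `1 - t` along the
path, so that both end edges carry `t` as the length is odd, and the points of the face are
determined by one coordinate on each path; these form a point of the original matching polytope.
-/

open MvPolynomial

section OmegaDegree

attribute [local instance] MvPolynomial.gradedAlgebra

variable {σ τ K : Type*} [Field K] {I : Ideal (MvPolynomial σ K)} {S T : Set (MvPolynomial σ K)}

lemma mem_span_of_mem_span_insert {f g : MvPolynomial σ K} {k n : ℕ} (hf : f.IsHomogeneous n)
    (hS : ∀ p ∈ S, ∃ d : ℕ, p.IsHomogeneous d) (hg : g.IsHomogeneous k) (hkn : k < n)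
    (hmem : g ∈ Ideal.span (insert f S)) : g ∈ Ideal.span S := by
  obtain ⟨a, b, hb, rfl⟩ := Ideal.mem_span_insert.1 hmem
  have hspan : (Ideal.span S).IsHomogeneous (homogeneousSubmodule σ K) :=
    Ideal.homogeneous_span _ S hS
  have haf : (DirectSum.decompose (homogeneousSubmodule σ K) (a * f) k : MvPolynomial σ K) = 0 :=
    DirectSum.coe_decompose_mul_of_right_mem_of_not_le _ hf hkn.not_ge
  rw [← DirectSum.decompose_of_mem_same (homogeneousSubmodule σ K) hg, DirectSum.decompose_add,
    DirectSum.add_apply, Submodule.coe_add, haf, zero_add]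
  exact hspan k hb

lemma exists_isMinimalGenerators_subset [Finite σ] (hT : ∀ f ∈ T, ∃ n : ℕ, f.IsHomogeneous n) :
    ∃ S ⊆ T, IsMinimalGenerators (Ideal.span T) S := by
  obtain ⟨T₀, hT₀, hspan⟩ := (Submodule.fg_span_iff_fg_span_finset_subset T).1
    (IsNoetherian.noetherian (Ideal.span T))
  obtain ⟨S, ⟨hST, hS⟩, hmin⟩ := exists_minimal_of_wellFoundedLT
    (fun S : Finset (MvPolynomial σ K) ↦ ↑S ⊆ T ∧ Ideal.span (S : Set (MvPolynomial σ K)) =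
      Ideal.span T) ⟨T₀, hT₀, hspan.symm⟩
  refine ⟨S, hST, fun f hf ↦ hT f (hST hf), hS, fun U hU hUT ↦ ?_⟩
  obtain ⟨U, rfl⟩ := (S.finite_toSet.subset hU.1).exists_finset_coe
  exact hU.2 (hmin ⟨hU.1.trans hST, hUT⟩ hU.1)

namespace IsMinimalGenerators

lemma zero_notMem (hS : IsMinimalGenerators I S) : 0 ∉ S := fun h0 ↦
  hS.minimal (S \ {0}) ⟨Set.sdiff_subset, fun h ↦ (h h0).2 rfl⟩
    (Submodule.span_sdiff_singleton_zero.trans hS.span_eq)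

lemma exists_totalDegree_le (hS : IsMinimalGenerators I S)
    (hT : ∀ g ∈ T, ∃ n : ℕ, g.IsHomogeneous n) (hTI : Ideal.span T = I)
    {f : MvPolynomial σ K} (hf : f ∈ S) : ∃ g ∈ T, f.totalDegree ≤ g.totalDegree := by
  by_contra! hlt
  refine hS.minimal (S \ {f}) ⟨Set.sdiff_subset, fun h ↦ (h hf).2 rfl⟩
    (le_antisymm ((Ideal.span_mono Set.sdiff_subset).trans hS.span_eq.le) ?_)
  rw [← hTI, Ideal.span_le]
  intro g hg
  obtain rfl | hg0 := eq_or_ne g 0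
  · exact zero_mem _
  obtain ⟨n, hn⟩ := hS.homogeneous f hf
  obtain ⟨k, hk⟩ := hT g hg
  have hkn : k < n := by
    rw [← hn.totalDegree (ne_of_mem_of_not_mem hf hS.zero_notMem), ← hk.totalDegree hg0]
    exact hlt g hg
  refine mem_span_of_mem_span_insert hn (fun p hp ↦ hS.homogeneous p hp.1) hk hkn ?_
  rw [Set.insert_sdiff_singleton, Set.insert_eq_of_mem hf, hS.span_eq, ← hTI]
  exact Ideal.subset_span hg

lemma totalDegree_le_omegaDegree (hS : IsMinimalGenerators I S) {f : MvPolynomial σ K}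
    (hf : f ∈ S) : (f.totalDegree : ℕ∞) ≤ omegaDegree I := by
  have hI : I ≠ ⊥ := by
    rintro rfl
    exact ne_of_mem_of_not_mem hf hS.zero_notMem (Ideal.span_eq_bot.1 hS.span_eq f hf)
  rw [omegaDegree, if_neg hI]
  exact le_sSup ⟨S, hS, f, hf, rfl⟩

end IsMinimalGenerators

lemma omegaDegree_span_le {d : ℕ∞} (hT : ∀ g ∈ T, ∃ n : ℕ, g.IsHomogeneous n)
    (hd : ∀ g ∈ T, (g.totalDegree : ℕ∞) ≤ d) (h2 : 2 ≤ d) : omegaDegree (Ideal.span T) ≤ d := by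
  rw [omegaDegree]
  split_ifs
  · exact h2
  · refine sSup_le ?_
    rintro _ ⟨S, hS, f, hf, rfl⟩
    obtain ⟨g, hg, hfg⟩ := hS.exists_totalDegree_le hT rfl hf
    exact (Nat.cast_le.2 hfg).trans (hd g hg)

lemma two_le_omegaDegree_span [Finite σ] (hT : ∀ g ∈ T, ∃ n : ℕ, g.IsHomogeneous n)
    (h2 : ∀ g ∈ T, g ≠ 0 → 2 ≤ g.totalDegree) : 2 ≤ omegaDegree (Ideal.span T) := by
  obtain ⟨S, hST, hS⟩ := exists_isMinimalGenerators_subset hT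
  obtain rfl | ⟨f, hf⟩ := S.eq_empty_or_nonempty
  · rw [← hS.span_eq, Ideal.span_empty, omegaDegree, if_pos rfl]
  · exact le_trans (mod_cast h2 f (hST hf) (ne_of_mem_of_not_mem hf hS.zero_notMem))
      (hS.totalDegree_le_omegaDegree hf)

lemma omegaDegree_map_span_le [Finite σ] {F : Type*}
    [FunLike F (MvPolynomial σ K) (MvPolynomial τ K)]
    [RingHomClass F (MvPolynomial σ K) (MvPolynomial τ K)]
    (hT : ∀ g ∈ T, ∃ n : ℕ, g.IsHomogeneous n) (h2 : 2 ≤ omegaDegree (Ideal.span T)) (π : F)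
    (hπ : ∀ (f : MvPolynomial σ K) (n : ℕ), f.IsHomogeneous n → (π f).IsHomogeneous n) :
    omegaDegree ((Ideal.span T).map π) ≤ omegaDegree (Ideal.span T) := by
  obtain ⟨S, -, hS⟩ := exists_isMinimalGenerators_subset hT
  nth_rw 1 [← hS.span_eq]
  rw [Ideal.map_span]
  refine omegaDegree_span_le ?_ ?_ h2
  · rintro _ ⟨f, hf, rfl⟩
    exact (hS.homogeneous f hf).imp (hπ f)
  · rintro _ ⟨f, hf, rfl⟩
    obtain ⟨n, hn⟩ := hS.homogeneous f hf
    refine le_trans ?_ (hS.totalDegree_le_omegaDegree hf)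
    rw [hn.totalDegree (ne_of_mem_of_not_mem hf hS.zero_notMem)]
    exact_mod_cast (hπ f n hn).totalDegree_le

end OmegaDegree

section Binomials

variable {R σ τ A B : Type*} [CommRing R]

/-- The differences of two monomials whose exponents have the same image under `g`. For additive
`g` they generate the kernel of the homomorphism of polynomial rings that `g` induces. -/
def binomials (R : Type*) [CommRing R] (g : (σ →₀ ℕ) → A) : Set (MvPolynomial σ R) :=
  {f | ∃ m m', g m = g m' ∧ monomial m 1 - monomial m' 1 = f}

lemma ker_eq_span_binomials (φ : MvPolynomial σ R →ₐ[R] MvPolynomial τ R)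
    {g : (σ →₀ ℕ) → τ →₀ ℕ} (hφ : ∀ m, φ (monomial m 1) = monomial (g m) 1) :
    RingHom.ker φ = Ideal.span (binomials R g) := by
  refine le_antisymm (fun f hf ↦ ?_) (Ideal.span_le.2 ?_)
  · let choosePreimage : MvPolynomial τ R →ₗ[R] MvPolynomial σ R :=
      (basisMonomials τ R).constr R fun b ↦ monomial (g.invFun b) 1
    have choosePreimage_monomial (b : τ →₀ ℕ) :
        choosePreimage (monomial b 1) = monomial (g.invFun b) 1 := by
      simpa only [coe_basisMonomials] using (basisMonomials τ R).constr_basis R _ b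
    have sub_mem (p : MvPolynomial σ R) :
        p - choosePreimage (φ p) ∈ Ideal.span (binomials R g) := by
      induction p using MvPolynomial.induction_on' with
      | monomial m c =>
        have hm : g m = g (g.invFun (g m)) := (Function.invFun_eq ⟨m, rfl⟩).symm
        have hc : monomial m c = c • monomial m (1 : R) := by
          rw [smul_monomial, smul_eq_mul, mul_one]
        rw [hc, map_smul, map_smul, ← smul_sub, hφ, choosePreimage_monomial]
        exact Submodule.smul_of_tower_mem _ c (Ideal.subset_span ⟨_, _, hm, rfl⟩)
      | add p q hp hq =>
        rw [map_add, map_add, add_sub_add_comm]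
        exact add_mem hp hq
    simpa only [RingHom.mem_ker.1 hf, map_zero, sub_zero] using sub_mem f
  · rintro _ ⟨m, m', h, rfl⟩
    simp only [SetLike.mem_coe, RingHom.mem_ker, map_sub, hφ, h, sub_self]

lemma isHomogeneous_of_mem_binomials {g : (σ →₀ ℕ) → A}
    (hg : ∀ m m', g m = g m' → m.degree = m'.degree) {f : MvPolynomial σ R}
    (hf : f ∈ binomials R g) : ∃ n : ℕ, f.IsHomogeneous n := by
  obtain ⟨m, m', h, rfl⟩ := hf
  exact ⟨m.degree, (isHomogeneous_monomial 1 rfl).sub (isHomogeneous_monomial 1 (hg m m' h).symm)⟩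

/-- Combinatorial pure subrings, in the terminology of Ohsugi, Herzog and Hibi. -/
lemma map_killCompl_span_binomials {ι : σ → τ} (hι : ι.Injective) {g : (σ →₀ ℕ) → A}
    {g' : (τ →₀ ℕ) → B}
    (hg : ∀ m m', g' (m.mapDomain ι) = g' (m'.mapDomain ι) ↔ g m = g m')
    (hface : ∀ m m', g' m = g' m' → ↑m.support ⊆ Set.range ι → ↑m'.support ⊆ Set.range ι) :
    (Ideal.span (binomials R g')).map (killCompl hι) = Ideal.span (binomials R g) := by
  refine le_antisymm (Ideal.map_le_iff_le_comap.2 (Ideal.span_le.2 ?_)) (Ideal.span_le.2 ?_)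
  · rintro _ ⟨m, m', h, rfl⟩
    rw [SetLike.mem_coe, Ideal.mem_comap, map_sub]
    by_cases hm : ↑m.support ⊆ Set.range ι
    · have hm' := hface m m' h hm
      rw [killCompl_monomial_eq_monomial_comapDomain_of_subset hι _ hm,
        killCompl_monomial_eq_monomial_comapDomain_of_subset hι _ hm']
      refine Ideal.subset_span ⟨_, _, (hg _ _).1 ?_, rfl⟩
      rwa [Finsupp.mapDomain_comapDomain ι hι m hm, Finsupp.mapDomain_comapDomain ι hι m' hm']
    · rw [killCompl_monomial_eq_zero_of_not_subset hι _ hm,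
        killCompl_monomial_eq_zero_of_not_subset hι _ (mt (hface m' m h.symm) hm), sub_zero]
      exact zero_mem _
  · rintro _ ⟨m, m', h, rfl⟩
    rw [← killCompl_monomial_mapDomain hι, ← killCompl_monomial_mapDomain hι, ← map_sub]
    exact Ideal.mem_map_of_mem _ (Ideal.subset_span ⟨_, _, (hg m m').2 h, rfl⟩)

lemma isHomogeneous_killCompl {ι : σ → τ} (hι : ι.Injective) {f : MvPolynomial τ R} {n : ℕ}
    (hf : f.IsHomogeneous n) : (killCompl hι f).IsHomogeneous n := by
  rw [← one_mul n]
  refine hf.aeval _ fun a ↦ ?_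
  split_ifs
  · exact isHomogeneous_X _ _
  · exact isHomogeneous_zero _ _ _

end Binomials

section ToricIdeal

variable {ι κ : Type*} {P F : Set (ι → ℝ)} {Q : Set (κ → ℝ)}

namespace LatticePoint

/-- A lattice point as a point of the real space. -/
def toReal (a : LatticePoint P) : ι → ℝ := fun i ↦ a.1 i

lemma toReal_mem (a : LatticePoint P) : a.toReal ∈ P := a.2

lemma toReal_mem_integerPoints (a : LatticePoint P) : a.toReal ∈ integerPoints ι :=
  fun i ↦ ⟨a.1 i, (Int.cast_natCast _).symm⟩

lemma toReal_injective : Function.Injective (toReal (P := P)) := fun _ _ h ↦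
  Subtype.ext (Finsupp.ext fun i ↦ Nat.cast_injective (congrFun h i))

lemma exists_toReal_eq [Finite ι] (hP : P ⊆ Set.Ici 0) {x : ι → ℝ} (hx : x ∈ P)
    (hxi : x ∈ integerPoints ι) : ∃ a : LatticePoint P, a.toReal = x := by
  have hnat (i : ι) : ∃ k : ℕ, (k : ℝ) = x i := by
    obtain ⟨n, hn⟩ := hxi i
    have hn0 : (0 : ℝ) ≤ n := hn ▸ hP hx i
    rw [Int.cast_nonneg_iff] at hn0
    lift n to ℕ using hn0
    exact ⟨n, hn.symm⟩
  choose a ha using hnat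
  obtain rfl : (fun i ↦ (a i : ℝ)) = x := funext ha
  exact ⟨⟨Finsupp.equivFunOnFinite.symm a, hx⟩, rfl⟩

/-- The inclusion of lattice points that an inclusion of sets induces. -/
def inclusion (h : F ⊆ P) (a : LatticePoint F) : LatticePoint P := ⟨a.1, h a.2⟩

lemma inclusion_injective (h : F ⊆ P) : Function.Injective (inclusion h) := fun _ _ hab ↦
  Subtype.ext ((Subtype.ext_iff (p := fun a : ι →₀ ℕ ↦ (fun i ↦ (a i : ℝ)) ∈ P)).1 hab)

lemma mem_range_inclusion (h : F ⊆ P) {a : LatticePoint P} :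
    a ∈ Set.range (inclusion h) ↔ a.toReal ∈ F :=
  ⟨by rintro ⟨a, rfl⟩; exact a.toReal_mem, fun ha ↦ ⟨⟨a.1, ha⟩, rfl⟩⟩

lemma finite_of_bddAbove [Finite ι] (hP : BddAbove P) : Finite (LatticePoint P) := by
  classical
  obtain ⟨b, hb⟩ := hP
  have := Fintype.ofFinite ι
  have hle (a : LatticePoint P) : ⇑a.1 ∈ Set.Icc 0 fun i ↦ ⌊b i⌋₊ :=
    ⟨fun _ ↦ Nat.zero_le _, fun i ↦ Nat.le_floor (hb a.2 i)⟩
  have : Finite (Set.range fun a : LatticePoint P ↦ ⇑a.1) :=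
    (Set.finite_Icc 0 fun i ↦ ⌊b i⌋₊).subset (Set.range_subset_iff.2 hle)
  exact Finite.of_injective_finite_range fun _ _ h ↦ Subtype.ext (DFunLike.coe_injective h)

end LatticePoint

open LatticePoint

/-- The exponent of the image of a monomial under the toric map, as an additive function of the
exponent of the monomial. -/
noncomputable def toricExponent (P : Set (ι → ℝ)) :
    (LatticePoint P →₀ ℕ) →ₗ[ℕ] (Option ι →₀ ℕ) :=
  Finsupp.linearCombination ℕ fun a ↦ a.1.mapDomain some + Finsupp.single none 1

lemma toricMap_monomial (K : Type*) [Field K] (m : LatticePoint P →₀ ℕ) :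
    toricMap K P (monomial m 1) = monomial (toricExponent P m) 1 := by
  simp only [toricMap, aeval_monomial, map_one, one_mul, rename_monomial, X, monomial_mul,
    monomial_pow, one_pow, mul_one, toricExponent, Finsupp.linearCombination_apply]
  rw [Finsupp.prod, Finsupp.sum, monomial_sum_one]

lemma toricIdeal_eq_span_binomials (K : Type*) [Field K] (P : Set (ι → ℝ)) :
    toricIdeal K P = Ideal.span (binomials K (toricExponent P)) :=
  ker_eq_span_binomials (toricMap K P) (toricMap_monomial K)

lemma toricExponent_none (m : LatticePoint P →₀ ℕ) : toricExponent P m none = m.degree := by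
  have h (a : ι →₀ ℕ) : a.mapDomain some none = 0 :=
    Finsupp.mapDomain_of_notMem_range _ _ (by simp)
  simp [toricExponent, Finsupp.linearCombination_apply, Finsupp.sum, Finsupp.finsetSum_apply, h,
    Finsupp.degree_apply]

lemma toricExponent_some (m : LatticePoint P →₀ ℕ) (i : ι) :
    (toricExponent P m (some i) : ℝ) = Finsupp.linearCombination ℕ toReal m i := by
  simp [toricExponent, Finsupp.linearCombination_apply, Finsupp.sum, Finsupp.finsetSum_apply,
    Finsupp.mapDomain_apply (Option.some_injective ι), toReal]

lemma toricExponent_eq_iff {m m' : LatticePoint P →₀ ℕ} :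
    toricExponent P m = toricExponent P m' ↔ m.degree = m'.degree ∧
      Finsupp.linearCombination ℕ toReal m = Finsupp.linearCombination ℕ toReal m' := by
  simp only [DFunLike.ext_iff (f := toricExponent P m), Option.forall, toricExponent_none,
    funext_iff, ← toricExponent_some, Nat.cast_inj]

lemma two_le_totalDegree_of_mem_binomials {K : Type*} [Field K]
    {f : MvPolynomial (LatticePoint P) K} (hf : f ∈ binomials K (toricExponent P)) (hf0 : f ≠ 0) :
    2 ≤ f.totalDegree := by
  obtain ⟨m, m', h, rfl⟩ := hf
  obtain ⟨hdeg, hsum⟩ := toricExponent_eq_iff.1 h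
  have hom : (monomial m (1 : K) - monomial m' 1).IsHomogeneous m.degree :=
    (isHomogeneous_monomial 1 rfl).sub (isHomogeneous_monomial 1 hdeg.symm)
  rw [hom.totalDegree hf0]
  by_contra! hlt
  suffices m = m' from hf0 (by rw [this, sub_self])
  obtain h0 | h1 : m.degree = 0 ∨ m.degree = 1 := by omega
  · rw [(Finsupp.degree_eq_zero_iff m).1 h0, (Finsupp.degree_eq_zero_iff m').1 (hdeg.symm.trans h0)]
  · obtain ⟨a, rfl⟩ := (Finsupp.sum_eq_one_iff m).1 h1
    obtain ⟨b, rfl⟩ := (Finsupp.sum_eq_one_iff m').1 (hdeg.symm.trans h1)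
    rw [Finsupp.linearCombination_single, Finsupp.linearCombination_single, one_smul,
      one_smul] at hsum
    rw [toReal_injective hsum]

lemma omegaDegree_toricIdeal_le_of_injective (K : Type*) [Field K] [Finite (LatticePoint Q)]
    {φ : LatticePoint P → LatticePoint Q} (hφ : φ.Injective)
    (hexp : ∀ m m', toricExponent Q (m.mapDomain φ) = toricExponent Q (m'.mapDomain φ) ↔
      toricExponent P m = toricExponent P m')
    (hface : ∀ m m', toricExponent Q m = toricExponent Q m' →
      ↑m.support ⊆ Set.range φ → ↑m'.support ⊆ Set.range φ) :
    omegaDegree (toricIdeal K P) ≤ omegaDegree (toricIdeal K Q) := by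
  have hhom (f) (hf : f ∈ binomials K (toricExponent Q)) : ∃ n : ℕ, f.IsHomogeneous n :=
    isHomogeneous_of_mem_binomials (fun m m' h ↦ (toricExponent_eq_iff.1 h).1) hf
  rw [toricIdeal_eq_span_binomials, toricIdeal_eq_span_binomials,
    ← map_killCompl_span_binomials hφ hexp hface]
  exact omegaDegree_map_span_le hhom
    (two_le_omegaDegree_span hhom fun _ ↦ two_le_totalDegree_of_mem_binomials) _
    fun f n ↦ isHomogeneous_killCompl hφ

lemma linearCombination_affineMap_comp {k σ E E' : Type*} [Ring k] [AddCommGroup E] [Module k E]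
    [AddCommGroup E'] [Module k E'] (f : E →ᵃ[k] E') (v : σ → E) (m : σ →₀ ℕ) :
    Finsupp.linearCombination ℕ (f ∘ v) m =
      f.linear (Finsupp.linearCombination ℕ v m) + m.degree • f 0 := by
  simp only [Finsupp.linearCombination_apply, Finsupp.sum, Function.comp_apply, map_sum, map_nsmul,
    Finsupp.degree_apply, Finset.sum_smul, ← Finset.sum_add_distrib, ← smul_add]
  exact Finset.sum_congr rfl fun a _ ↦ by rw [congrFun f.decomp (v a), Pi.add_apply]

lemma toReal_mem_of_toricExponent_eq (hF : IsExposed ℝ P F) {m m' : LatticePoint P →₀ ℕ}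
    (h : toricExponent P m = toricExponent P m') (hm : ∀ a ∈ m.support, a.toReal ∈ F) :
    ∀ a ∈ m'.support, a.toReal ∈ F := by
  obtain ⟨hdeg, hsum⟩ := toricExponent_eq_iff.1 h
  obtain rfl | ⟨a₀, ha₀⟩ := m.support.eq_empty_or_nonempty.imp_left Finsupp.support_eq_empty.1
  · obtain rfl := (Finsupp.degree_eq_zero_iff m').1 (hdeg.symm.trans (map_zero _))
    simp
  obtain ⟨l, rfl⟩ := hF ⟨_, hm a₀ ha₀⟩
  have hmax := (hm a₀ ha₀).2
  have hl (n : LatticePoint P →₀ ℕ) : l (Finsupp.linearCombination ℕ toReal n) =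
      ∑ a ∈ n.support, n a * l a.toReal := by
    simp only [Finsupp.linearCombination_apply, Finsupp.sum, map_sum, map_nsmul]
    simp only [nsmul_eq_mul]
  have hc (n : LatticePoint P →₀ ℕ) : n.degree * l a₀.toReal =
      ∑ a ∈ n.support, n a * l a₀.toReal := by
    rw [Finsupp.degree_apply, Nat.cast_sum, Finset.sum_mul]
  have heq : ∑ a ∈ m'.support, m' a * l a.toReal = ∑ a ∈ m'.support, m' a * l a₀.toReal := by
    rw [← hl, ← hc, ← hsum, ← hdeg, hl, hc]
    refine Finset.sum_congr rfl fun a ha ↦ ?_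
    rw [(hmax _ a.toReal_mem).antisymm ((hm a ha).2 _ a₀.toReal_mem)]
  have hle (a : LatticePoint P) (_ : a ∈ m'.support) :
      m' a * l a.toReal ≤ m' a * l a₀.toReal :=
    mul_le_mul_of_nonneg_left (hmax _ a.toReal_mem) (Nat.cast_nonneg _)
  intro a ha
  have hla := (Finset.sum_eq_sum_iff_of_le hle).1 heq a ha
  rw [mul_right_inj' (Nat.cast_ne_zero.2 (Finsupp.mem_support_iff.1 ha))] at hla
  exact ⟨a.toReal_mem, hla ▸ hmax⟩

lemma omegaDegree_toricIdeal_le_of_isExposed (K : Type*) [Field K] [Finite (LatticePoint P)]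
    (hF : IsExposed ℝ P F) : omegaDegree (toricIdeal K F) ≤ omegaDegree (toricIdeal K P) := by
  have hexp (m : LatticePoint F →₀ ℕ) :
      toricExponent P (m.mapDomain (inclusion hF.subset)) = toricExponent F m :=
    Finsupp.linearCombination_mapDomain ℕ _ m
  refine omegaDegree_toricIdeal_le_of_injective K (inclusion_injective hF.subset)
    (fun m m' ↦ by rw [hexp, hexp]) fun m m' h hm a ha ↦ ?_
  exact (mem_range_inclusion hF.subset).2 (toReal_mem_of_toricExponent_eq hF h
    (fun b hb ↦ (mem_range_inclusion hF.subset).1 (hm hb)) a ha)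

lemma linearCombination_sub_linearCombination_mem_vectorSpan {k σ E : Type*} [Ring k]
    [AddCommGroup E] [Module k E] {s : Set E} {v : σ → E} (hv : ∀ a, v a ∈ s) {m m' : σ →₀ ℕ}
    (h : m.degree = m'.degree) :
    Finsupp.linearCombination ℕ v m - Finsupp.linearCombination ℕ v m' ∈ vectorSpan k s := by
  obtain rfl | ⟨a₀, -⟩ := m.support.eq_empty_or_nonempty.imp_left Finsupp.support_eq_empty.1
  · obtain rfl := (Finsupp.degree_eq_zero_iff m').1 (h.symm.trans (map_zero _))
    rw [sub_self]
    exact zero_mem _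
  · have hmem (n : σ →₀ ℕ) :
        Finsupp.linearCombination ℕ v n - n.degree • v a₀ ∈ vectorSpan k s := by
      rw [Finsupp.linearCombination_apply, Finsupp.sum, Finsupp.degree_apply, Finset.sum_smul,
        ← Finset.sum_sub_distrib]
      refine sum_mem fun a _ ↦ ?_
      rw [← smul_sub]
      exact nsmul_mem (vsub_mem_vectorSpan k (hv a) (hv a₀)) _
    simpa only [h, sub_sub_sub_cancel_right] using sub_mem (hmem m) (hmem m')

lemma toricExponent_mapDomain_eq_iff {φ : LatticePoint P → LatticePoint Q}
    {f : (ι → ℝ) →ᵃ[ℝ] (κ → ℝ)} (hf : Set.InjOn f (affineSpan ℝ P))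
    (hφ : ∀ a, (φ a).toReal = f a.toReal) (m m' : LatticePoint P →₀ ℕ) :
    toricExponent Q (m.mapDomain φ) = toricExponent Q (m'.mapDomain φ) ↔
      toricExponent P m = toricExponent P m' := by
  rw [toricExponent_eq_iff, toricExponent_eq_iff, Finsupp.degree_mapDomain,
    Finsupp.degree_mapDomain]
  refine and_congr_right fun hdeg ↦ ?_
  rw [Finsupp.linearCombination_mapDomain, Finsupp.linearCombination_mapDomain,
    show toReal ∘ φ = f ∘ toReal from funext hφ, linearCombination_affineMap_comp,
    linearCombination_affineMap_comp, hdeg, add_left_inj]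
  refine ⟨fun h ↦ ?_, congrArg _⟩
  obtain rfl | ⟨a₀, -⟩ := m.support.eq_empty_or_nonempty.imp_left Finsupp.support_eq_empty.1
  · rw [(Finsupp.degree_eq_zero_iff m').1 (hdeg.symm.trans (map_zero _))]
  have ha₀ : a₀.toReal ∈ affineSpan ℝ P := subset_affineSpan ℝ P a₀.toReal_mem
  have hd := linearCombination_sub_linearCombination_mem_vectorSpan (k := ℝ) toReal_mem hdeg
  rw [← direction_affineSpan] at hd
  have hd₀ := AffineSubspace.vadd_mem_of_mem_direction hd ha₀
  refine sub_eq_zero.1 (add_eq_right.1 (hf hd₀ ha₀ ?_))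
  rw [f.map_vadd, map_sub, h, sub_self, zero_vadd]

lemma exists_latticePoint_equiv [Finite ι] [Finite κ] (hP : P ⊆ Set.Ici 0) (hQ : Q ⊆ Set.Ici 0)
    (h : UnimodularlyIsomorphic P Q) :
    ∃ (φ : LatticePoint P ≃ LatticePoint Q) (f : (ι → ℝ) →ᵃ[ℝ] (κ → ℝ)),
      Set.InjOn f (affineSpan ℝ P) ∧ ∀ a, (φ a).toReal = f a.toReal := by
  obtain ⟨f, hinj, rfl, hint⟩ := h
  have hspan (a : LatticePoint P) : a.toReal ∈ affineSpan ℝ P :=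
    subset_affineSpan ℝ P a.toReal_mem
  have hf (a : LatticePoint P) : ∃ b : LatticePoint (f '' P), b.toReal = f a.toReal :=
    exists_toReal_eq hQ ⟨_, a.toReal_mem, rfl⟩
      (hint.subset ⟨_, ⟨hspan a, a.toReal_mem_integerPoints⟩, rfl⟩).2
  choose φ hφ using hf
  refine ⟨Equiv.ofBijective φ ⟨fun a b hab ↦ ?_, fun b ↦ ?_⟩, f, hinj, hφ⟩
  · exact toReal_injective (hinj (hspan a) (hspan b) (by rw [← hφ, ← hφ, hab]))
  · obtain ⟨x, hx, hxb⟩ := b.toReal_mem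
    obtain ⟨y, ⟨hy, hyi⟩, hyb⟩ :=
      hint.superset ⟨subset_affineSpan ℝ _ b.toReal_mem, b.toReal_mem_integerPoints⟩
    obtain rfl := hinj (subset_affineSpan ℝ P hx) hy (hxb.trans hyb.symm)
    obtain ⟨a, rfl⟩ := exists_toReal_eq hP hx hyi
    exact ⟨a, toReal_injective ((hφ a).trans hxb)⟩

lemma UnimodularlyIsomorphic.omegaDegree_toricIdeal_eq [Finite ι] [Finite κ] (K : Type*) [Field K]
    [Finite (LatticePoint P)] (hP : P ⊆ Set.Ici 0) (hQ : Q ⊆ Set.Ici 0)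
    (h : UnimodularlyIsomorphic P Q) :
    omegaDegree (toricIdeal K P) = omegaDegree (toricIdeal K Q) := by
  obtain ⟨φ, f, hf, hφ⟩ := exists_latticePoint_equiv hP hQ h
  have : Finite (LatticePoint Q) := .of_equiv _ φ
  have hexp := toricExponent_mapDomain_eq_iff hf hφ
  have hsymm (m : LatticePoint Q →₀ ℕ) : (m.mapDomain φ.symm).mapDomain φ = m := by
    rw [← Finsupp.mapDomain_comp, φ.self_comp_symm, Finsupp.mapDomain_id]
  apply le_antisymm
  · exact omegaDegree_toricIdeal_le_of_injective K φ.injective hexp fun _ _ _ _ a _ ↦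
      φ.surjective a
  · refine omegaDegree_toricIdeal_le_of_injective K φ.symm.injective (fun m m' ↦ ?_)
      fun _ _ _ _ a _ ↦ φ.symm.surjective a
    rw [← hexp, hsymm, hsymm]

end ToricIdeal
section Convexity

variable {E : Type*} [AddCommGroup E] [Module ℝ E] {s : Set E}

lemma le_of_mem_convexHull (l : E →ₗ[ℝ] ℝ) {c : ℝ} (hs : ∀ x ∈ s, l x ≤ c) {x : E}
    (hx : x ∈ convexHull ℝ s) : l x ≤ c :=
  convexHull_min hs (convex_halfSpace_le l.isLinear c) hx

lemma mem_convexHull_sep_eq (l : E →ₗ[ℝ] ℝ) {c : ℝ} (hs : ∀ x ∈ s, l x ≤ c) {x : E}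
    (hx : x ∈ convexHull ℝ s) (hxc : l x = c) : x ∈ convexHull ℝ {y ∈ s | l y = c} := by
  have hsub : convexHull ℝ s ⊆ {x | l x ≤ c ∧ (l x = c → x ∈ convexHull ℝ {y ∈ s | l y = c})} := by
    refine convexHull_min (fun x hx ↦ ⟨hs x hx, fun h ↦ subset_convexHull ℝ _ ⟨hx, h⟩⟩) ?_
    rw [convex_iff_forall_pos]
    rintro y ⟨hy, hy'⟩ z ⟨hz, hz'⟩ a b ha hb hab
    have hl : l (a • y + b • z) = a * l y + b * l z := by
      rw [map_add, map_smul, map_smul, smul_eq_mul, smul_eq_mul]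
    have hc : a * c + b * c = c := by rw [← add_mul, hab, one_mul]
    have hay := mul_le_mul_of_nonneg_left hy ha.le
    have hbz := mul_le_mul_of_nonneg_left hz hb.le
    refine ⟨by linarith, fun h ↦ ?_⟩
    have hyc : l y = c := hy.antisymm (le_of_mul_le_mul_left (by linarith) ha)
    have hzc : l z = c := hz.antisymm (le_of_mul_le_mul_left (by linarith) hb)
    exact convex_convexHull ℝ _ (hy' hyc) (hz' hzc) ha.le hb.le hab
  exact (hsub hx).2 hxc

variable [TopologicalSpace E]

lemma isExposed_convexHull_sep_eq (l : E →L[ℝ] ℝ) {c : ℝ} (hs : ∀ x ∈ s, l x ≤ c) :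
    IsExposed ℝ (convexHull ℝ s) (convexHull ℝ {x ∈ s | l x = c}) := by
  intro hne
  obtain ⟨x₀, hx₀, hx₀c⟩ := convexHull_nonempty_iff.1 hne
  have hle {x : E} (hx : x ∈ convexHull ℝ s) : l x ≤ c := le_of_mem_convexHull l.toLinearMap hs hx
  refine ⟨l, Set.Subset.antisymm (fun x hx ↦ ⟨convexHull_mono (Set.sep_subset _ _) hx, ?_⟩) ?_⟩
  · have hxc : l x = c :=
      convexHull_min (fun y hy ↦ hy.2) (convex_hyperplane l.toLinearMap.isLinear c) hx
    exact fun y hy ↦ (hle hy).trans hxc.ge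
  · rintro x ⟨hx, hmax⟩
    exact mem_convexHull_sep_eq l.toLinearMap hs hx
      ((hle hx).antisymm (hx₀c.ge.trans (hmax x₀ (subset_convexHull ℝ s hx₀))))

lemma isExposed_convexHull_sep_forall_eq [ContinuousAdd E] {J : Type*} [Finite J]
    (l : J → E →L[ℝ] ℝ) {c : J → ℝ} (hs : ∀ x ∈ s, ∀ j, l j x ≤ c j) :
    IsExposed ℝ (convexHull ℝ s) (convexHull ℝ {x ∈ s | ∀ j, l j x = c j}) := by
  have := Fintype.ofFinite J
  have hsum (x : E) : (∑ j, l j) x = ∑ j, l j x := sum_apply _ _ _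
  have hset : {x ∈ s | ∀ j, l j x = c j} = {x ∈ s | (∑ j, l j) x = ∑ j, c j} := by
    refine Set.ext fun x ↦ and_congr_right fun hx ↦ ?_
    rw [hsum, Finset.sum_eq_sum_iff_of_le fun j _ ↦ hs x hx j]
    simp only [Finset.mem_univ, true_imp_iff]
  rw [hset]
  refine isExposed_convexHull_sep_eq _ fun x hx ↦ ?_
  rw [hsum]
  exact Finset.sum_le_sum fun j _ ↦ hs x hx j

end Convexity

lemma UnimodularlyIsomorphic.of_leftInverse {ι κ : Type*} {f : (κ → ℝ) →ᵃ[ℝ] (ι → ℝ)}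
    {g : (ι → ℝ) →ᵃ[ℝ] (κ → ℝ)} (hgf : Function.LeftInverse g f)
    (hf : Set.MapsTo f (integerPoints κ) (integerPoints ι))
    (hg : Set.MapsTo g (integerPoints ι) (integerPoints κ)) (Q : Set (κ → ℝ)) :
    UnimodularlyIsomorphic (f '' Q) Q := by
  have hspan : (affineSpan ℝ (f '' Q) : Set (ι → ℝ)) = f '' affineSpan ℝ Q := by
    rw [← AffineSubspace.map_span, AffineSubspace.coe_map]
  refine ⟨g, ?_, hgf.image_image Q, ?_⟩ <;> rw [hspan]
  · rintro _ ⟨x, -, rfl⟩ _ ⟨y, -, rfl⟩ h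
    rw [← hgf x, h, hgf y]
  · ext x
    constructor
    · rintro ⟨_, ⟨⟨y, hy, rfl⟩, hyi⟩, rfl⟩
      exact ⟨(hgf y).symm ▸ hy, hg hyi⟩
    · rintro ⟨hx, hxi⟩
      exact ⟨f x, ⟨⟨x, hx, rfl⟩, hf hxi⟩, hgf x⟩

section StableSets

variable {E : Type*} {H : SimpleGraph E}

/-- The `(0,1)`-vectors of the stable sets of a graph. The matching polytope of `G` is the convex
hull of those of the line graph of `G`. -/
def stableIndicators (H : SimpleGraph E) : Set (E → ℝ) :=
  {x | ∃ M : Set E, H.IsIndepSet M ∧ x = M.indicator fun _ ↦ 1}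

lemma mem_stableIndicators_iff {x : E → ℝ} :
    x ∈ stableIndicators H ↔
      (∀ e, x e = 0 ∨ x e = 1) ∧ ∀ e f, H.Adj e f → x e + x f ≤ 1 := by
  classical
  constructor
  · rintro ⟨M, hM, rfl⟩
    refine ⟨fun e ↦ (Set.indicator_eq_zero_or_self M _ e), fun e f hef ↦ ?_⟩
    by_cases he : e ∈ M
    · have hf : f ∉ M := fun hf ↦ hM he hf hef.ne hef
      rw [Set.indicator_of_mem he, Set.indicator_of_notMem hf, add_zero]
    · rw [Set.indicator_of_notMem he, zero_add]
      exact Set.indicator_le_self' (fun _ _ ↦ zero_le_one) f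
  · rintro ⟨h01, hadj⟩
    refine ⟨{e | x e = 1}, fun e he f hf _ hef ↦ ?_, funext fun e ↦ ?_⟩
    · have := hadj e f hef
      rw [Set.mem_ofPred_eq] at he hf
      linarith
    · obtain h | h := h01 e <;> simp [h]

lemma stableIndicators_subset_Icc (H : SimpleGraph E) : stableIndicators H ⊆ Set.Icc 0 1 := by
  intro x hx
  have h01 := (mem_stableIndicators_iff.1 hx).1
  exact ⟨fun e ↦ by obtain h | h := h01 e <;> simp [h],
    fun e ↦ by obtain h | h := h01 e <;> simp [h]⟩

lemma matchingPolytope_subset_Icc {V : Type*} (G : SimpleGraph V) :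
    matchingPolytope G ⊆ Set.Icc 0 1 :=
  convexHull_min (stableIndicators_subset_Icc G.lineGraph) (convex_Icc 0 1)

end StableSets

/-- Data exhibiting `H'` as obtained from `H` by replacing every vertex by a connected bipartite
graph, with colour classes called black and white, and realizing the edges of `H` between black
vertices. The line graph of an odd subdivision is of this form over the line graph of the original
graph: an edge is replaced by a path of edges, and those in even position, counted from `0`, are
black. -/
structure BipartiteInflation {E A : Type*} (H : SimpleGraph E) (H' : SimpleGraph A) where
  /-- the vertex that was replaced -/
  proj : A → E
  /-- the black vertices -/
  black : Set A
  /-- a black vertex of every bipartite graph -/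
  base : E → A
  proj_base : ∀ e, proj (base e) = e
  base_mem : ∀ e, base e ∈ black
  adj : ∀ {a b : A}, H'.Adj a b →
    proj a = proj b ∧ (a ∈ black ↔ b ∉ black) ∨
      H.Adj (proj a) (proj b) ∧ a ∈ black ∧ b ∈ black
  lift_adj : ∀ {e f : E}, H.Adj e f →
    ∃ a ∈ black, ∃ b ∈ black, proj a = e ∧ proj b = f ∧ H'.Adj a b
  connected : ∀ a : A,
    Relation.ReflTransGen (fun b c ↦ H'.Adj b c ∧ proj b = proj c) (base (proj a)) a

namespace BipartiteInflation

variable {E A : Type*} {H : SimpleGraph E} {H' : SimpleGraph A} (D : BipartiteInflation H H')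

open Classical in
/-- The affine map that copies a coordinate to the black vertices of its bipartite graph and its
complement to `1` to the white ones. -/
noncomputable def inflate : (E → ℝ) →ᵃ[ℝ] (A → ℝ) :=
  AffineMap.pi fun a ↦
    if a ∈ D.black then (LinearMap.proj (D.proj a)).toAffineMap
    else AffineMap.const ℝ _ 1 - (LinearMap.proj (D.proj a)).toAffineMap

lemma inflate_of_mem {a : A} (ha : a ∈ D.black) (x : E → ℝ) :
    D.inflate x a = x (D.proj a) := by
  simp [inflate, ha]

lemma inflate_of_notMem {a : A} (ha : a ∉ D.black) (x : E → ℝ) :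
    D.inflate x a = 1 - x (D.proj a) := by
  simp [inflate, ha]

lemma inflate_add_inflate {a b : A} (h : H'.Adj a b) (hab : D.proj a = D.proj b) (x : E → ℝ) :
    D.inflate x a + D.inflate x b = 1 := by
  obtain ⟨-, halt⟩ | ⟨hne, -⟩ := D.adj h
  · by_cases hb : b ∈ D.black
    · rw [D.inflate_of_notMem (fun ha ↦ halt.1 ha hb), D.inflate_of_mem hb, hab, sub_add_cancel]
    · rw [D.inflate_of_mem (halt.2 hb), D.inflate_of_notMem hb, hab, add_sub_cancel]
  · exact absurd hab hne.ne

/-- The affine map that reads off the coordinates of the base vertices. -/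
def restrict : (A → ℝ) →ᵃ[ℝ] (E → ℝ) := (LinearMap.funLeft ℝ ℝ D.base).toAffineMap

lemma restrict_apply (x : A → ℝ) (e : E) : D.restrict x e = x (D.base e) := rfl

lemma restrict_inflate : Function.LeftInverse D.restrict D.inflate := fun x ↦ funext fun e ↦ by
  rw [restrict_apply, D.inflate_of_mem (D.base_mem e), D.proj_base]

lemma inflate_restrict {x : A → ℝ}
    (hx : ∀ a b, H'.Adj a b → D.proj a = D.proj b → x a + x b = 1) :
    D.inflate (D.restrict x) = x := by
  have hreach {e : E} {a : A}
      (h : Relation.ReflTransGen (fun b c ↦ H'.Adj b c ∧ D.proj b = D.proj c) (D.base e) a) :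
      D.inflate (D.restrict x) a = x a := by
    induction h with
    | refl => rw [D.inflate_of_mem (D.base_mem e), restrict_apply, D.proj_base]
    | tail _ hbc ih =>
      linarith [hx _ _ hbc.1 hbc.2, D.inflate_add_inflate hbc.1 hbc.2 (D.restrict x)]
  exact funext fun a ↦ hreach (D.connected a)

lemma mapsTo_inflate_integerPoints :
    Set.MapsTo D.inflate (integerPoints E) (integerPoints A) := by
  intro x hx a
  obtain ⟨n, hn⟩ := hx (D.proj a)
  by_cases ha : a ∈ D.black
  · exact ⟨n, by rw [D.inflate_of_mem ha, hn]⟩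
  · exact ⟨1 - n, by rw [D.inflate_of_notMem ha, hn, Int.cast_sub, Int.cast_one]⟩

lemma inflate_mem_stableIndicators {x : E → ℝ} (hx : x ∈ stableIndicators H) :
    D.inflate x ∈ stableIndicators H' := by
  obtain ⟨h01, hadj⟩ := mem_stableIndicators_iff.1 hx
  refine mem_stableIndicators_iff.2 ⟨fun a ↦ ?_, fun a b h ↦ ?_⟩
  · by_cases ha : a ∈ D.black
    · rw [D.inflate_of_mem ha]
      exact h01 _
    · rw [D.inflate_of_notMem ha, sub_eq_zero, sub_eq_self, eq_comm]
      exact (h01 _).symm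
  · obtain ⟨hab, -⟩ | ⟨hab, ha, hb⟩ := D.adj h
    · exact (D.inflate_add_inflate h hab x).le
    · rw [D.inflate_of_mem ha, D.inflate_of_mem hb]
      exact hadj _ _ hab

lemma mem_stableIndicators_of_inflate_mem {x : E → ℝ} (hx : D.inflate x ∈ stableIndicators H') :
    x ∈ stableIndicators H := by
  obtain ⟨h01, hadj⟩ := mem_stableIndicators_iff.1 hx
  refine mem_stableIndicators_iff.2 ⟨fun e ↦ ?_, fun e f h ↦ ?_⟩
  · simpa only [D.inflate_of_mem (D.base_mem e), D.proj_base] using h01 (D.base e)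
  · obtain ⟨a, ha, b, hb, rfl, rfl, hab⟩ := D.lift_adj h
    simpa only [D.inflate_of_mem ha, D.inflate_of_mem hb] using hadj a b hab

lemma image_inflate_stableIndicators :
    D.inflate '' stableIndicators H =
      {x ∈ stableIndicators H' | ∀ a b, H'.Adj a b → D.proj a = D.proj b → x a + x b = 1} := by
  ext x
  constructor
  · rintro ⟨y, hy, rfl⟩
    exact ⟨D.inflate_mem_stableIndicators hy, fun a b h hab ↦ D.inflate_add_inflate h hab y⟩
  · rintro ⟨hx, htight⟩
    have hinv := D.inflate_restrict htight
    exact ⟨D.restrict x, D.mem_stableIndicators_of_inflate_mem (hinv.symm ▸ hx), hinv⟩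

lemma isExposed_image_inflate [Finite A] :
    IsExposed ℝ (convexHull ℝ (stableIndicators H'))
      (D.inflate '' convexHull ℝ (stableIndicators H)) := by
  rw [AffineMap.image_convexHull, image_inflate_stableIndicators]
  let l (q : {q : A × A // H'.Adj q.1 q.2 ∧ D.proj q.1 = D.proj q.2}) : (A → ℝ) →L[ℝ] ℝ :=
    .proj q.1.1 + .proj q.1.2
  have := isExposed_convexHull_sep_forall_eq l (c := 1) (s := stableIndicators H')
    fun x hx q ↦ (mem_stableIndicators_iff.1 hx).2 _ _ q.2.1
  simpa [l] using this

lemma unimodularlyIsomorphic_image_inflate (Q : Set (E → ℝ)) :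
    UnimodularlyIsomorphic (D.inflate '' Q) Q :=
  .of_leftInverse D.restrict_inflate D.mapsTo_inflate_integerPoints (fun _ hx e ↦ hx (D.base e)) Q

end BipartiteInflation

namespace OddSubdivision

variable {V W : Type*} {G : SimpleGraph V} {G' : SimpleGraph W}

/-- The first end of an edge, for an arbitrary orientation of the edges. -/
noncomputable def src (e : G.edgeSet) : V := (Quot.out e.1).1

/-- The second end of an edge, for the same orientation as `src`. -/
noncomputable def tgt (e : G.edgeSet) : V := (Quot.out e.1).2

lemma mk_src_tgt (e : G.edgeSet) : s(src e, tgt e) = e.1 := Quot.out_eq e.1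

lemma adj_src_tgt (e : G.edgeSet) : G.Adj (src e) (tgt e) := by
  rw [← SimpleGraph.mem_edgeSet, mk_src_tgt]
  exact e.2

variable (D : OddSubdivision G G')

lemma mem_edges_path_iff {u v a b : V} (h : G.Adj u v) (k : G.Adj a b) (hk : s(u, v) = s(a, b))
    (e' : Sym2 W) : e' ∈ (D.path h).edges ↔ e' ∈ (D.path k).edges := by
  obtain ⟨rfl, rfl⟩ | ⟨rfl, rfl⟩ := Sym2.eq_iff.1 hk
  · rfl
  · rw [D.path_symm h, SimpleGraph.Walk.edges_reverse, List.mem_reverse]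

/-- The path that replaces an edge, traversed from `src` to `tgt`. -/
noncomputable def walk (e : G.edgeSet) : G'.Walk (D.vert (src e)) (D.vert (tgt e)) :=
  D.path (adj_src_tgt e)

lemma odd_length_walk (e : G.edgeSet) : Odd (D.walk e).length := D.odd_length _

lemma eq_of_getVert_walk_eq {e : G.edgeSet} {i j : ℕ} (hi : i ≤ (D.walk e).length)
    (hj : j ≤ (D.walk e).length) (h : (D.walk e).getVert i = (D.walk e).getVert j) : i = j :=
  (D.isPath (adj_src_tgt e)).getVert_injOn hi hj h

lemma mem_of_vert_mem_support_walk {e : G.edgeSet} {x : V} (h : D.vert x ∈ (D.walk e).support) :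
    x ∈ e.1 := by
  rw [← mk_src_tgt e, Sym2.mem_iff]
  exact D.inner_new _ x h

lemma exists_mem_of_mem_support_walk {e f : G.edgeSet} (hef : e ≠ f) {w : W}
    (he : w ∈ (D.walk e).support) (hf : w ∈ (D.walk f).support) :
    ∃ x ∈ e.1, x ∈ f.1 ∧ D.vert x = w := by
  have hne : s(src e, tgt e) ≠ s(src f, tgt f) := by
    rw [mk_src_tgt, mk_src_tgt]
    exact Subtype.coe_injective.ne hef
  obtain ⟨x, rfl⟩ := D.inner_disjoint _ _ hne w he hf
  exact ⟨x, D.mem_of_vert_mem_support_walk he, D.mem_of_vert_mem_support_walk hf, rfl⟩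

lemma eq_zero_or_eq_length_of_getVert_walk_eq_vert {e : G.edgeSet} {i : ℕ}
    (hi : i ≤ (D.walk e).length) {x : V} (h : (D.walk e).getVert i = D.vert x) :
    i = 0 ∨ i = (D.walk e).length := by
  obtain rfl | rfl := D.inner_new _ x (h ▸ (D.walk e).getVert_mem_support i)
  · exact Or.inl (D.eq_of_getVert_walk_eq hi (Nat.zero_le _)
      (h.trans (D.walk e).getVert_zero.symm))
  · exact Or.inr (D.eq_of_getVert_walk_eq hi le_rfl (h.trans (D.walk e).getVert_length.symm))

/-- The edge of the subdivision in a given position on the path that replaces an edge. -/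
noncomputable def pathEdge (p : Σ e : G.edgeSet, Fin (D.walk e).length) : G'.edgeSet :=
  ⟨s((D.walk p.1).getVert p.2, (D.walk p.1).getVert (p.2 + 1)),
    (D.walk p.1).adj_getVert_succ p.2.2⟩

lemma exists_getVert_eq_of_mem_pathEdge {p : Σ e : G.edgeSet, Fin (D.walk e).length} {w : W}
    (hw : w ∈ (D.pathEdge p).1) :
    ∃ k ≤ (D.walk p.1).length, (k = p.2 ∨ k = p.2 + 1) ∧ (D.walk p.1).getVert k = w := by
  obtain rfl | rfl := Sym2.mem_iff.1 hw
  · exact ⟨_, p.2.2.le, Or.inl rfl, rfl⟩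
  · exact ⟨_, p.2.2, Or.inr rfl, rfl⟩

lemma mem_support_walk_of_mem_pathEdge {p : Σ e : G.edgeSet, Fin (D.walk e).length} {w : W}
    (hw : w ∈ (D.pathEdge p).1) : w ∈ (D.walk p.1).support := by
  obtain ⟨k, -, -, rfl⟩ := D.exists_getVert_eq_of_mem_pathEdge hw
  exact SimpleGraph.Walk.getVert_mem_support _ _

lemma even_of_vert_mem_pathEdge {p : Σ e : G.edgeSet, Fin (D.walk e).length} {x : V}
    (hx : D.vert x ∈ (D.pathEdge p).1) : Even (p.2 : ℕ) := by
  obtain ⟨k, hk, hkp, hkx⟩ := D.exists_getVert_eq_of_mem_pathEdge hx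
  have hend := D.eq_zero_or_eq_length_of_getVert_walk_eq_vert hk hkx
  have hodd := D.odd_length_walk p.1
  grind

lemma exists_even_of_mem {e : G.edgeSet} {x : V} (hx : x ∈ e.1) :
    ∃ i : Fin (D.walk e).length, Even (i : ℕ) ∧ D.vert x ∈ (D.pathEdge ⟨e, i⟩).1 := by
  have hpos := (D.odd_length_walk e).pos
  rw [← mk_src_tgt e, Sym2.mem_iff] at hx
  obtain rfl | rfl := hx
  · exact ⟨⟨0, hpos⟩, Even.zero, Sym2.mem_iff.2 (Or.inl (D.walk e).getVert_zero.symm)⟩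
  · refine ⟨⟨(D.walk e).length - 1, Nat.sub_lt hpos one_pos⟩,
      (D.odd_length_walk e).tsub_odd odd_one, Sym2.mem_iff.2 (Or.inr ?_)⟩
    change _ = (D.walk e).getVert ((D.walk e).length - 1 + 1)
    rw [Nat.sub_add_cancel hpos, SimpleGraph.Walk.getVert_length]

lemma pathEdge_injective : Function.Injective D.pathEdge := by
  rintro ⟨e, i⟩ ⟨f, j⟩ h
  obtain rfl | hef := eq_or_ne e f
  · refine Sigma.ext rfl (heq_of_eq (Fin.ext ?_))
    obtain ⟨hij, -⟩ | ⟨hij, hji⟩ := Sym2.eq_iff.1 (Subtype.ext_iff.1 h)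
    · exact D.eq_of_getVert_walk_eq i.2.le j.2.le hij
    · have := D.eq_of_getVert_walk_eq i.2.le j.2 hij
      have := D.eq_of_getVert_walk_eq i.2 j.2.le hji
      omega
  -- Otherwise both ends of the edge are original vertices that belong to `e` and to `f`.
  · have hmeet {w : W} (hw : w ∈ (D.pathEdge ⟨e, i⟩).1) : ∃ x ∈ e.1, x ∈ f.1 ∧ D.vert x = w :=
      D.exists_mem_of_mem_support_walk hef (D.mem_support_walk_of_mem_pathEdge hw)
        (D.mem_support_walk_of_mem_pathEdge (p := ⟨f, j⟩) (h ▸ hw))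
    obtain ⟨x, hxe, hxf, hx⟩ := hmeet (Sym2.mem_mk_left _ _)
    obtain ⟨y, hye, hyf, hy⟩ := hmeet (Sym2.mem_mk_right _ _)
    have hxy : x ≠ y := by
      rintro rfl
      exact ((D.walk e).adj_getVert_succ i.2).ne (hx.symm.trans hy)
    exact absurd (Subtype.ext (((Sym2.mem_and_mem_iff hxy).1 ⟨hxe, hye⟩).trans
      ((Sym2.mem_and_mem_iff hxy).1 ⟨hxf, hyf⟩).symm)) hef

lemma pathEdge_surjective : Function.Surjective D.pathEdge := by
  rintro ⟨e', he'⟩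
  obtain ⟨u, v, h, he⟩ := D.edge_cover e' he'
  let e : G.edgeSet := ⟨s(u, v), h⟩
  rw [D.mem_edges_path_iff h (adj_src_tgt e) (mk_src_tgt e).symm] at he
  induction e' with
  | _ a b =>
    obtain ⟨i, hi, hab⟩ := (SimpleGraph.Walk.mk_mem_edges_iff_exists _).1 he
    exact ⟨⟨e, i, hi⟩, Subtype.ext hab⟩

/-- The edges of the subdivision, as pairs of an original edge and a position on the path that
replaces it. -/
noncomputable def edgeEquiv : (Σ e : G.edgeSet, Fin (D.walk e).length) ≃ G'.edgeSet :=
  Equiv.ofBijective D.pathEdge ⟨D.pathEdge_injective, D.pathEdge_surjective⟩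

lemma lineGraph_adj_of_lineGraph_adj_pathEdge {p q : Σ e : G.edgeSet, Fin (D.walk e).length}
    (h : G'.lineGraph.Adj (D.pathEdge p) (D.pathEdge q)) :
    p.1 = q.1 ∧ (Even (p.2 : ℕ) ↔ ¬ Even (q.2 : ℕ)) ∨
      G.lineGraph.Adj p.1 q.1 ∧ Even (p.2 : ℕ) ∧ Even (q.2 : ℕ) := by
  obtain ⟨hne, w, hp, hq⟩ := SimpleGraph.lineGraph_adj_iff_exists.1 h
  by_cases hpq : p.1 = q.1
  · refine Or.inl ⟨hpq, ?_⟩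
    obtain ⟨e, i⟩ := p
    obtain ⟨f, j⟩ := q
    obtain rfl : e = f := hpq
    obtain ⟨k, hk, hki, rfl⟩ := D.exists_getVert_eq_of_mem_pathEdge hp
    obtain ⟨l, hl, hlj, hlk⟩ := D.exists_getVert_eq_of_mem_pathEdge hq
    have hkl := D.eq_of_getVert_walk_eq hl hk hlk
    have hij : (i : ℕ) ≠ j := fun hij ↦ hne (by rw [Fin.ext hij])
    grind
  · obtain ⟨x, hxp, hxq, rfl⟩ := D.exists_mem_of_mem_support_walk hpq
      (D.mem_support_walk_of_mem_pathEdge hp) (D.mem_support_walk_of_mem_pathEdge hq)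
    exact Or.inr ⟨SimpleGraph.lineGraph_adj_iff_exists.2 ⟨hpq, x, hxp, hxq⟩,
      D.even_of_vert_mem_pathEdge hp, D.even_of_vert_mem_pathEdge hq⟩

lemma exists_even_lineGraph_adj_pathEdge {e f : G.edgeSet} (h : G.lineGraph.Adj e f) :
    ∃ (i : Fin (D.walk e).length) (j : Fin (D.walk f).length), Even (i : ℕ) ∧ Even (j : ℕ) ∧
      G'.lineGraph.Adj (D.pathEdge ⟨e, i⟩) (D.pathEdge ⟨f, j⟩) := by
  obtain ⟨hef, x, hxe, hxf⟩ := SimpleGraph.lineGraph_adj_iff_exists.1 h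
  obtain ⟨i, hi, hxi⟩ := D.exists_even_of_mem hxe
  obtain ⟨j, hj, hxj⟩ := D.exists_even_of_mem hxf
  exact ⟨i, j, hi, hj, SimpleGraph.lineGraph_adj_iff_exists.2
    ⟨fun hij ↦ hef (congrArg Sigma.fst (D.pathEdge_injective hij)), D.vert x, hxi, hxj⟩⟩

lemma lineGraph_adj_pathEdge_succ (e : G.edgeSet) {i : ℕ} (hi : i + 1 < (D.walk e).length) :
    G'.lineGraph.Adj (D.pathEdge ⟨e, i, i.lt_succ_self.trans hi⟩) (D.pathEdge ⟨e, i + 1, hi⟩) := by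
  refine SimpleGraph.lineGraph_adj_iff_exists.2 ⟨fun h ↦ ?_, (D.walk e).getVert (i + 1),
    Sym2.mem_mk_right _ _, Sym2.mem_mk_left _ _⟩
  simpa using D.pathEdge_injective h

/-- The line graph of an odd subdivision as an inflation of the line graph of the original graph.
The base of a path is its edge in position `0`. -/
noncomputable def lineGraphInflation : BipartiteInflation G.lineGraph G'.lineGraph where
  proj a := (D.edgeEquiv.symm a).1
  black := {a | Even ((D.edgeEquiv.symm a).2 : ℕ)}
  base e := D.edgeEquiv ⟨e, 0, (D.odd_length_walk e).pos⟩
  proj_base e := by rw [Equiv.symm_apply_apply]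
  base_mem e := by
    rw [Set.mem_ofPred_eq, Equiv.symm_apply_apply]
    exact Even.zero
  adj {a b} h := by
    obtain ⟨p, rfl⟩ := D.edgeEquiv.surjective a
    obtain ⟨q, rfl⟩ := D.edgeEquiv.surjective b
    rw [Set.mem_ofPred_eq, Set.mem_ofPred_eq, Equiv.symm_apply_apply, Equiv.symm_apply_apply]
    exact D.lineGraph_adj_of_lineGraph_adj_pathEdge h
  lift_adj {e f} h := by
    obtain ⟨i, j, hi, hj, hadj⟩ := D.exists_even_lineGraph_adj_pathEdge h
    refine ⟨D.edgeEquiv ⟨e, i⟩, ?_, D.edgeEquiv ⟨f, j⟩, ?_, ?_, ?_, hadj⟩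
    · rwa [Set.mem_ofPred_eq, Equiv.symm_apply_apply]
    · rwa [Set.mem_ofPred_eq, Equiv.symm_apply_apply]
    · rw [Equiv.symm_apply_apply]
    · rw [Equiv.symm_apply_apply]
  connected a := by
    obtain ⟨⟨e, i, hi⟩, rfl⟩ := D.edgeEquiv.surjective a
    rw [Equiv.symm_apply_apply]
    induction i with
    | zero => exact .refl
    | succ i ih =>
      refine (ih (i.lt_succ_self.trans hi)).tail ⟨D.lineGraph_adj_pathEdge_succ e hi, ?_⟩
      rw [Equiv.symm_apply_apply, Equiv.symm_apply_apply]

end OddSubdivision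

theorem proposition5 {V W : Type*} [Finite V] [Finite W]
    (G : SimpleGraph V) (G' : SimpleGraph W) (hG' : IsOddSubdivision G G') :
    (∃ F : Set (G'.edgeSet → ℝ), IsExposed ℝ (matchingPolytope G') F ∧
      UnimodularlyIsomorphic F (matchingPolytope G)) ∧
    ∀ (K : Type*) [Field K],
      omegaDegree (toricIdeal K (matchingPolytope G)) ≤
        omegaDegree (toricIdeal K (matchingPolytope G')) := by
  obtain ⟨D⟩ := hG'
  have hexp := D.lineGraphInflation.isExposed_image_inflate
  have hiso := D.lineGraphInflation.unimodularlyIsomorphic_image_inflate (matchingPolytope G)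
  refine ⟨⟨_, hexp, hiso⟩, fun K _ ↦ ?_⟩
  have hG := matchingPolytope_subset_Icc G
  have hG' := matchingPolytope_subset_Icc G'
  have hface := hexp.subset.trans hG'
  have := LatticePoint.finite_of_bddAbove (bddAbove_Icc.mono hG')
  have := LatticePoint.finite_of_bddAbove (bddAbove_Icc.mono hface)
  calc omegaDegree (toricIdeal K (matchingPolytope G))
      = omegaDegree (toricIdeal K (D.lineGraphInflation.inflate '' matchingPolytope G)) :=
        (hiso.omegaDegree_toricIdeal_eq K (hface.trans Set.Icc_subset_Ici_self)
          (hG.trans Set.Icc_subset_Ici_self)).symm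
    _ ≤ omegaDegree (toricIdeal K (matchingPolytope G')) :=
        omegaDegree_toricIdeal_le_of_isExposed K hexp
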